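/- Consider single-item auctions with $n$ buyers, and write $\mathbb{R}_+=[0,\infty)$. Let $\mathcal{F}_1,\dots,\mathcal{F}_n$ be classes of probability distributions on $\mathbb{R}_+$, each containing all distributions of finite mean (in particular, each $\mathcal F_i$ may be the class of all distributions on $\mathbb{R}_+$), and let $\boldsymbol{\mathcal F}=\mathcal F_1\times\cdots\times\mathcal F_n$. A *distribution-reporting mechanism* $M=(x,p)$ consists of allocation rules $x_i:\mathbb{R}_+^n\times\boldsymbol{\mathcal F}\to[0,1]$ and payment rules $p_i:\boldsymbol{\mathcal F}\to\mathbb{R}$, $i\in[n]$; here $x_i(\boldsymbol b;\boldsymbol B)$ is the probability that buyer $i$ gets the item when the reported distributions are $\boldsymbol B$ and the bids are $\boldsymbol b$. If the reports are $\boldsymbol B$ and buyer $i$ has the true value distribution $F_i$, her ex-ante utility is $$U_i^M(\boldsymbol B;F_i)=\mathbb{E}_{q\sim U[0,1],\ \boldsymbol b_{-i}\sim\boldsymbol B_{-i}}\big[x_i(b_i(q),\boldsymbol b_{-i};\boldsymbol B)\,v_i(q)\big]-p_i(\boldsymbol B)\in(-\infty,\infty],$$ where $v_i(q)=F_i^{-1}(1-q)$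 and $b_i(q)=B_i^{-1}(1-q)$ are the quantile functions of $F_i$ and $B_i$, and $q$ and the bids $b_j\sim B_j$ ($j\ne i$) are independent. The mechanism is *valid* if it is - ex-ante incentive compatible: $U_i^M(F_i,\boldsymbol B_{-i};F_i)\ge U_i^M(B_i,\boldsymbol B_{-i};F_i)$ for all $i$, all $F_i\in\mathcal F_i$ and all $\boldsymbol B\in\boldsymbol{\mathcal F}$; - ex-ante individually rational: $U_i^M(\boldsymbol F;F_i)\ge 0$ for all $\boldsymbol F\in\boldsymbol{\mathcal F}$ and all $i$; and - feasible: $\sum_{i}x_i(\boldsymbol b;\boldsymbol B)\le 1$ for all $\boldsymbol b\in\mathbb{R}_+^n$ and $\boldsymbol B\in\boldsymbol{\mathcal F}$. Its revenue on an instance $\boldsymbol F\in\boldsymbol{\mathcal F}$ is $\mathrm{REV}(M,\boldsymbol F)=\sum_i p_i(\boldsymbol F)$. Let $\mathrm{WEL}(\boldsymbol F)$ and $\mathrm{SPA}(\boldsymbol F)$ be the expectations of the highest and of the second-highest (counted with multiplicity) of independent values $v_i\sim F_i$, $i\in[n]$. **Theorem.** Let $n\ge 2$ be an integer and let $K\ge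 6$ be a real number. For every valid distribution-reporting mechanism $M$ there is an instance $\boldsymbol F\in\boldsymbol{\mathcal F}$ with $\mathrm{SPA}(\boldsymbol F)>0$ and $\mathrm{WEL}(\boldsymbol F)<\infty$ such that $$\mathrm{REV}(M,\boldsymbol F)\le\min\Big\{\frac{64}{K+\log_2 n}\,\mathrm{WEL}(\boldsymbol F),\ 2^K\,\mathrm{SPA}(\boldsymbol F)\Big\}.$$ -/

import Mathlib

noncomputable section

open MeasureTheory
open scoped NNReal ENNReal

namespace DistReport

/-- Distributions on `[0, ∞)`; the class of all distributions is `Set.univ : Set Dist`. -/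
abbrev Dist : Type := ProbabilityMeasure ℝ≥0

/-- The mean of a distribution, as a value in `[0, ∞]`. -/
def mean (D : Dist) : ℝ≥0∞ := ∫⁻ v, (v : ℝ≥0∞) ∂(D : Measure ℝ≥0)

/-- The quantile function `v(q) = F⁻¹(1 - q)`, where `F⁻¹` is the generalized inverse of the
cumulative distribution function. It is used for `q` uniform on `[0, 1]`; at `q = 0` (a null set)
the value is `0` if the distribution has unbounded support. -/
def quantile (D : Dist) (q : ℝ) : ℝ≥0 :=
  sInf {t : ℝ≥0 | 1 - q ≤ (D : Measure ℝ≥0).real (Set.Iic t)}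

/-- Distribution profiles: one member of the class `𝓕 i` for every buyer `i`. -/
abbrev Profile {n : ℕ} (𝓕 : Fin n → Set Dist) : Type := ∀ i, 𝓕 i

/-- The joint law of independent draws, the `i`-th one from the `i`-th distribution. -/
def joint {n : ℕ} {𝓕 : Fin n → Set Dist} (B : Profile 𝓕) : Measure (Fin n → ℝ≥0) :=
  Measure.pi fun i => ((B i : Dist) : Measure ℝ≥0)

/-- A distribution-reporting mechanism for the distribution classes `𝓕`: allocation probabilities
depending on the bids and on the reported distributions (measurable in the bids, so that
expectations make sense), and payments depending on the reported distributions. -/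
structure Mechanism {n : ℕ} (𝓕 : Fin n → Set Dist) where
  alloc : Fin n → (Fin n → ℝ≥0) → Profile 𝓕 → ℝ≥0
  pay : Fin n → Profile 𝓕 → ℝ
  alloc_le_one : ∀ i b B, alloc i b B ≤ 1
  measurable_alloc : ∀ i B, Measurable fun b => alloc i b B

namespace Mechanism

variable {n : ℕ} {𝓕 : Fin n → Set Dist}

/-- `E[x_i(b_i(q), b_{-i}; B) · v_i(q)]` for `q` uniform on `[0, 1]` and independent
`b_{-i} ∼ B_{-i}`, where `b_i(·)` and `v_i(·)` are the quantile functions of the reported `B_i` and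
of the true `D`. The `i`-th coordinate of `b` is overwritten, so only `b_{-i}` matters. -/
def expectedValue (M : Mechanism 𝓕) (i : Fin n) (B : Profile 𝓕) (D : Dist) : ℝ≥0∞ :=
  ∫⁻ q in Set.Icc (0 : ℝ) 1, ∫⁻ b,
    (M.alloc i (Function.update b i (quantile (B i) q)) B : ℝ≥0∞) * (quantile D q : ℝ≥0∞) ∂joint B

/-- The ex-ante utility of buyer `i` with true distribution `D` when the reports are `B`. It is
`⊤` exactly if the expected value obtained is infinite. -/
def utility (M : Mechanism 𝓕) (i : Fin n) (B : Profile 𝓕) (D : Dist) : EReal :=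
  (M.expectedValue i B D : EReal) - (M.pay i B : EReal)

/-- Ex-ante incentive compatibility: whatever the others report, reporting the true distribution
`D` maximizes the ex-ante utility over all reports in the class. -/
def ExAnteIC (M : Mechanism 𝓕) : Prop :=
  ∀ (i : Fin n) (D : 𝓕 i) (B : Profile 𝓕),
    M.utility i B D ≤ M.utility i (Function.update B i D) D

/-- Ex-ante individual rationality. -/
def ExAnteIR (M : Mechanism 𝓕) : Prop :=
  ∀ (F : Profile 𝓕) (i : Fin n), 0 ≤ M.utility i F (F i)

/-- Single-item feasibility. -/
def Feasible (M : Mechanism 𝓕) : Prop :=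
  ∀ (b : Fin n → ℝ≥0) (B : Profile 𝓕), ∑ i, M.alloc i b B ≤ 1

structure Valid (M : Mechanism 𝓕) : Prop where
  exAnteIC : M.ExAnteIC
  exAnteIR : M.ExAnteIR
  feasible : M.Feasible

/-- The expected revenue under truthful reports. -/
def rev (M : Mechanism 𝓕) (F : Profile 𝓕) : ℝ := ∑ i, M.pay i F

end Mechanism

/-- The highest entry of a vector. -/
def highest {n : ℕ} (v : Fin n → ℝ≥0) : ℝ≥0 := Finset.univ.sup v

/-- The second-highest entry of a vector, counted with multiplicity: the largest number that is at
most `v i` and at most `v j` for two distinct indices `i`, `j`. -/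
def secondHighest {n : ℕ} (v : Fin n → ℝ≥0) : ℝ≥0 :=
  (Finset.univ.offDiag : Finset (Fin n × Fin n)).sup fun p => min (v p.1) (v p.2)

/-- The optimal expected social welfare. -/
def WEL {n : ℕ} {𝓕 : Fin n → Set Dist} (F : Profile 𝓕) : ℝ≥0∞ :=
  ∫⁻ v, (highest v : ℝ≥0∞) ∂joint F

/-- The expected revenue of the second-price auction. -/
def SPA {n : ℕ} {𝓕 : Fin n → Set Dist} (F : Profile 𝓕) : ℝ≥0∞ :=
  ∫⁻ v, (secondHighest v : ℝ≥0∞) ∂joint F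

end DistReport

end

noncomputable section

open MeasureTheory
open scoped NNReal ENNReal

namespace DistReport

/-! Write `S = K + log₂ n`. If `S ≤ 64`, point masses at 1 suffice: welfare and second price are at
least 1, revenue is at most 1, and both factors are at least 1.

If `S > 64`, the instance is found by averaging. Buyer `i` has value `2 ^ t i / p` with probability
`p = 1 / (2n)` and 0 otherwise, where the scales `t i` are independent with a truncated
equal-revenue law on `0, …, m`, `m = ⌊S / 4⌋`. For fixed reports, the value she obtains is linear in
her true scale `2 ^ k`, with slope at most 1. Against fixed opponents she thus faces a
single-parameter menu over scales, and the equal-revenue prior caps her expected payment at 1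
(`sum_scaleWeight_mul_pay_scaleProfile_le`). Expected revenue is therefore at most `n`.

The benchmarks are larger. High values are rare enough that welfare is at least half of `∑ 2 ^ t i`,
whose mean is of order `n * S`, and common enough that the second price is always at least `n / 16`.
The minimum of the two bounds is estimated from below by a quadratic in `∑ 2 ^ t i`
(`sub_sq_div_le_min`), so two moments suffice to show that its mean exceeds `n`
(`lt_expected_benchmark`). Hence some scale profile satisfies the claim. -/

/-! ### Independent sampling from a finite weighted set -/

section Sampling

variable {ι κ : Type*} [Fintype ι] [DecidableEq ι] [Fintype κ]

/-- Replacing one coordinate of a product sample by a fresh draw does not change expectations. -/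
lemma sum_prod_mul_resample (w : κ → ℝ) (g : (ι → κ) → ℝ) (i : ι) :
    ∑ t : ι → κ, (∏ j, w (t j)) * ∑ k, w k * g (Function.update t i k) =
      (∑ k, w k) * ∑ t : ι → κ, (∏ j, w (t j)) * g t := by
  -- Swapping coordinate `i` with the fresh draw is an involution that preserves the product weight.
  let e : (ι → κ) × κ → (ι → κ) × κ := fun x => (Function.update x.1 i x.2, x.1 i)
  have he : Function.Involutive e := by
    rintro ⟨t, k⟩
    simp [e]
  have key : ∀ (t : ι → κ) (k : κ), (∏ j, w (t j)) * w k =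
      (∏ j, w (Function.update t i k j)) * w (t i) := by
    intro t k
    rw [← Finset.mul_prod_erase Finset.univ (fun j => w (t j)) (Finset.mem_univ i),
      ← Finset.mul_prod_erase Finset.univ (fun j => w (Function.update t i k j))
        (Finset.mem_univ i)]
    have : ∏ j ∈ Finset.univ.erase i, w (Function.update t i k j) =
        ∏ j ∈ Finset.univ.erase i, w (t j) := by
      refine Finset.prod_congr rfl fun j hj => ?_
      rw [Function.update_of_ne (Finset.ne_of_mem_erase hj)]
    rw [this, Function.update_self]
    ring
  calc ∑ t : ι → κ, (∏ j, w (t j)) * ∑ k, w k * g (Function.update t i k)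
      = ∑ x : (ι → κ) × κ, (∏ j, w ((e x).1 j)) * w (e x).2 * g (e x).1 := by
        rw [Fintype.sum_prod_type]
        refine Finset.sum_congr rfl fun t _ => ?_
        rw [Finset.mul_sum]
        refine Finset.sum_congr rfl fun k _ => ?_
        rw [← mul_assoc, key]
    _ = ∑ x : (ι → κ) × κ, (∏ j, w (x.1 j)) * w x.2 * g x.1 :=
        Equiv.sum_comp (he.toPerm e) (fun x : (ι → κ) × κ => (∏ j, w (x.1 j)) * w x.2 * g x.1)
    _ = (∑ k, w k) * ∑ t : ι → κ, (∏ j, w (t j)) * g t := by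
        rw [Fintype.sum_prod_type, Finset.mul_sum]
        refine Finset.sum_congr rfl fun t _ => ?_
        rw [Finset.sum_mul]
        refine Finset.sum_congr rfl fun k _ => ?_
        ring

variable {w : κ → ℝ}

lemma sum_prod_eq_one (hw : ∑ k, w k = 1) : ∑ t : ι → κ, ∏ j, w (t j) = 1 := by
  have := Finset.prod_univ_sum (fun _ : ι => (Finset.univ : Finset κ)) (fun _ k => w k)
  rw [Fintype.piFinset_univ] at this
  rw [← this]
  simp [hw]

/-- Expectation of a function of a single coordinate. -/
lemma sum_prod_mul_apply (hw : ∑ k, w k = 1) (f : κ → ℝ) (i : ι) :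
    ∑ t : ι → κ, (∏ j, w (t j)) * f (t i) = ∑ k, w k * f k := by
  have h := sum_prod_mul_resample w (fun t => f (t i)) i
  simp only [Function.update_self] at h
  rw [← Finset.sum_mul, sum_prod_eq_one hw, hw, one_mul, one_mul] at h
  exact h.symm

/-- Expectation of a product of functions of two different coordinates. -/
lemma sum_prod_mul_apply_mul_apply (hw : ∑ k, w k = 1) (f : κ → ℝ) {i j : ι} (hij : i ≠ j) :
    ∑ t : ι → κ, (∏ l, w (t l)) * (f (t i) * f (t j)) = (∑ k, w k * f k) ^ 2 := by
  have h := sum_prod_mul_resample w (fun t => f (t i) * f (t j)) i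
  simp only [Function.update_self, Function.update_of_ne hij.symm] at h
  rw [hw, one_mul] at h
  rw [← h, sq]
  nth_rewrite 2 [← sum_prod_mul_apply hw f j]
  rw [Finset.mul_sum]
  refine Finset.sum_congr rfl fun t _ => ?_
  simp only [← mul_assoc, ← Finset.sum_mul]
  ring

/-- The mean of a sum of independent copies. -/
lemma sum_prod_mul_sum (hw : ∑ k, w k = 1) (f : κ → ℝ) :
    ∑ t : ι → κ, (∏ l, w (t l)) * ∑ i, f (t i) = Fintype.card ι * ∑ k, w k * f k := by
  simp_rw [Finset.mul_sum (Finset.univ : Finset ι)]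
  rw [Finset.sum_comm]
  simp_rw [sum_prod_mul_apply hw]
  simp

/-- The second moment of a sum of independent copies. -/
lemma sum_prod_mul_sum_sq_le (hw : ∑ k, w k = 1) (f : κ → ℝ) :
    ∑ t : ι → κ, (∏ l, w (t l)) * (∑ i, f (t i)) ^ 2 ≤
      Fintype.card ι * ∑ k, w k * f k ^ 2 + (Fintype.card ι * ∑ k, w k * f k) ^ 2 := by
  have h1 : ∑ t : ι → κ, (∏ l, w (t l)) * (∑ i, f (t i)) ^ 2 =
      ∑ i, ∑ j, ∑ t : ι → κ, (∏ l, w (t l)) * (f (t i) * f (t j)) := by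
    simp_rw [sq, Finset.sum_mul_sum, Finset.mul_sum (Finset.univ : Finset ι)]
    rw [Finset.sum_comm]
    refine Finset.sum_congr rfl fun i _ => ?_
    rw [Finset.sum_comm]
  have h2 : ∀ i j : ι, ∑ t : ι → κ, (∏ l, w (t l)) * (f (t i) * f (t j)) ≤
      (if i = j then ∑ k, w k * f k ^ 2 else 0) + (∑ k, w k * f k) ^ 2 := by
    intro i j
    by_cases hij : i = j
    · subst hij
      have := sum_prod_mul_apply hw (fun k => f k ^ 2) i
      rw [if_pos rfl, ← this]
      simp only [← sq]
      linarith [sq_nonneg (∑ k, w k * f k)]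
    · rw [sum_prod_mul_apply_mul_apply hw f hij, if_neg hij, zero_add]
  rw [h1]
  refine (Finset.sum_le_sum fun i _ => Finset.sum_le_sum fun j _ => h2 i j).trans_eq ?_
  simp [Finset.sum_add_distrib]
  ring

end Sampling

/-! ### The truncated geometric prior on scales -/

/-- The weight of the scale `2 ^ k` for `k ≤ m`: the probability of a scale at least `2 ^ k`
is `2⁻ᵏ`. -/
def scaleWeight (m k : ℕ) : ℝ := if k < m then (1 / 2) ^ (k + 1) else (1 / 2) ^ k

lemma scaleWeight_nonneg (m k : ℕ) : 0 ≤ scaleWeight m k := by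
  unfold scaleWeight
  split_ifs <;> positivity

lemma sum_scaleWeight_mul (m : ℕ) (f : ℕ → ℝ) :
    ∑ k : Fin (m + 1), scaleWeight m k * f k =
      ∑ k ∈ Finset.range m, (1 / 2) ^ (k + 1) * f k + (1 / 2) ^ m * f m := by
  rw [Fin.sum_univ_eq_sum_range (fun k => scaleWeight m k * f k), Finset.sum_range_succ]
  congr 1
  · refine Finset.sum_congr rfl fun k hk => ?_
    rw [scaleWeight, if_pos (Finset.mem_range.1 hk)]
  · rw [scaleWeight, if_neg (lt_irrefl m)]

lemma sum_scaleWeight (m : ℕ) : ∑ k : Fin (m + 1), scaleWeight m k = 1 := by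
  have h := sum_scaleWeight_mul m fun _ => 1
  simp only [mul_one] at h
  rw [h]
  clear h
  induction m with
  | zero => simp
  | succ m ih =>
    rw [Finset.sum_range_succ, add_assoc, ← two_mul, pow_succ _ m]
    linarith

/-- Every scale below the top contributes 1/2 and the top one contributes 1. This mean grows
linearly in `m`, while the extractable payment stays at most 1; the gap drives the theorem. -/
lemma sum_scaleWeight_mul_scale (m : ℕ) :
    ∑ k : Fin (m + 1), scaleWeight m k * 2 ^ (k : ℕ) = m / 2 + 1 := by
  rw [sum_scaleWeight_mul m fun k => 2 ^ k]
  have h : ∀ k : ℕ, (1 / 2 : ℝ) ^ k * 2 ^ k = 1 := fun k => by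
    rw [← mul_pow]; norm_num
  simp only [pow_succ, mul_right_comm _ (1 / 2 : ℝ), h]
  rw [Finset.sum_const, Finset.card_range, nsmul_eq_mul]
  ring

/-- The contributions form a geometric series dominated by the top scale, so the second moment is
controlled once `2 ^ m` is. -/
lemma sum_scaleWeight_mul_scale_sq_le (m : ℕ) :
    ∑ k : Fin (m + 1), scaleWeight m k * (2 ^ (k : ℕ)) ^ 2 ≤ 3 / 2 * 2 ^ m := by
  rw [sum_scaleWeight_mul m fun k => (2 ^ k) ^ 2]
  have h : ∀ k : ℕ, (1 / 2 : ℝ) ^ k * (2 ^ k) ^ 2 = 2 ^ k := fun k => by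
    rw [sq, ← mul_assoc, ← mul_pow]; norm_num
  simp only [pow_succ (1 / 2 : ℝ), mul_right_comm _ (1 / 2 : ℝ), h]
  rw [← Finset.sum_mul, geom_sum_eq (by norm_num)]
  norm_num
  linarith

/-- A buyer whose scale is drawn from the truncated geometric prior pays at most `1` in expectation
under any menu that is incentive compatible between consecutive scales and individually rational
at the lowest scale. -/
lemma sum_scaleWeight_mul_pay_le_one (m : ℕ) (y p : ℕ → ℝ) (hy : y m ≤ 1)
    (hIR : p 0 ≤ y 0)
    (hIC : ∀ k < m, 2 ^ (k + 1) * y k - p k ≤ 2 ^ (k + 1) * y (k + 1) - p (k + 1)) :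
    ∑ k : Fin (m + 1), scaleWeight m k * p k ≤ 1 := by
  rw [sum_scaleWeight_mul]
  have h : ∀ k : ℕ, (1 / 2 : ℝ) ^ k * 2 ^ k = 1 := fun k => by
    rw [← mul_pow]; norm_num
  -- The potential is `2⁻ᵏ` times the truthful utility at scale `2 ^ k`. Not mimicking the next
  -- lower scale makes it grow by at least the weighted payment at that lower scale.
  have key : ∀ k ≤ m, ∑ j ∈ Finset.range k, (1 / 2) ^ (j + 1) * p j ≤
      (1 / 2) ^ k * (2 ^ k * y k - p k) := by
    intro k
    induction k with
    | zero => intro _; simpa using hIR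
    | succ k ih =>
      intro hk
      rw [Finset.sum_range_succ]
      have h1 := ih (by omega)
      have h2 := mul_le_mul_of_nonneg_left (hIC k (by omega))
        (by positivity : (0 : ℝ) ≤ (1 / 2) ^ (k + 1))
      have h3 : (1 / 2 : ℝ) ^ (k + 1) * (2 ^ (k + 1) * y k - p k) =
          (1 / 2) ^ k * (2 ^ k * y k - p k) + (1 / 2) ^ (k + 1) * p k := by
        rw [pow_succ, pow_succ]; ring
      linarith
  have := key m le_rfl
  -- The top weight is `2⁻ᵐ`, not half of it, so the top payment cancels against the potential and
  -- only `y m ≤ 1` remains.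
  have h4 : (1 / 2 : ℝ) ^ m * (2 ^ m * y m - p m) = y m - (1 / 2) ^ m * p m := by
    rw [mul_sub, ← mul_assoc, h, one_mul]
  linarith

/-! ### Two-point distributions -/

/-- The distribution with value `a` with probability `p` and value `0` otherwise. -/
def twoPoint (p : ℝ≥0) (hp : p ≤ 1) (a : ℝ≥0) : Dist :=
  ⟨(p : ℝ≥0∞) • Measure.dirac a + ((1 - p : ℝ≥0) : ℝ≥0∞) • Measure.dirac 0, ⟨by
    simp only [Measure.coe_add, Measure.coe_smul, Pi.add_apply, Pi.smul_apply, measure_univ,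
      smul_eq_mul, mul_one]
    rw [← ENNReal.coe_add, add_tsub_cancel_of_le hp, ENNReal.coe_one]⟩⟩

section TwoPoint

variable {p : ℝ≥0} (hp : p ≤ 1)

lemma coe_twoPoint (a : ℝ≥0) : (twoPoint p hp a : Measure ℝ≥0) =
    (p : ℝ≥0∞) • Measure.dirac a + ((1 - p : ℝ≥0) : ℝ≥0∞) • Measure.dirac 0 := rfl

lemma mean_twoPoint (a : ℝ≥0) : mean (twoPoint p hp a) = p * a := by
  rw [mean, coe_twoPoint, lintegral_add_measure, lintegral_smul_measure, lintegral_smul_measure,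
    lintegral_dirac, lintegral_dirac]
  simp

lemma mean_twoPoint_lt_top (a : ℝ≥0) : mean (twoPoint p hp a) < ⊤ := by
  rw [mean_twoPoint]
  exact ENNReal.mul_lt_top ENNReal.coe_lt_top ENNReal.coe_lt_top

lemma le_twoPoint_singleton (a : ℝ≥0) : (p : ℝ≥0∞) ≤ (twoPoint p hp a : Measure ℝ≥0) {a} := by
  rw [coe_twoPoint]
  simp

lemma le_twoPoint_singleton_zero (a : ℝ≥0) :
    ((1 - p : ℝ≥0) : ℝ≥0∞) ≤ (twoPoint p hp a : Measure ℝ≥0) {0} := by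
  rw [coe_twoPoint]
  simp

lemma twoPoint_real_Iic (a t : ℝ≥0) : (twoPoint p hp a : Measure ℝ≥0).real (Set.Iic t) =
    (if a ≤ t then (p : ℝ) else 0) + (1 - p) := by
  rw [Measure.real, coe_twoPoint]
  by_cases h : a ≤ t
  · simp only [Measure.coe_add, Measure.coe_smul, Pi.add_apply, Pi.smul_apply,
      measurableSet_Iic, Measure.dirac_apply', smul_eq_mul]
    simp [Set.indicator, h, ENNReal.toReal_add, NNReal.coe_sub hp, -ENNReal.coe_sub]
  · simp only [Measure.coe_add, Measure.coe_smul, Pi.add_apply, Pi.smul_apply,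
      measurableSet_Iic, Measure.dirac_apply', smul_eq_mul]
    simp [Set.indicator, h, NNReal.coe_sub hp, -ENNReal.coe_sub]

lemma quantile_twoPoint (a : ℝ≥0) {q : ℝ} (hq : q ∈ Set.Icc (0 : ℝ) 1) :
    quantile (twoPoint p hp a) q = if q < p then a else 0 := by
  unfold quantile
  simp only [twoPoint_real_Iic]
  obtain ⟨h0, -⟩ := hq
  split_ifs with h
  · have : {t : ℝ≥0 | 1 - q ≤ (if a ≤ t then (p : ℝ) else 0) + (1 - p)} = Set.Ici a := by
      ext t
      by_cases hat : a ≤ t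
      · simp [hat, h0]
      · simp only [Set.mem_ofPred_eq, hat, if_false, Set.mem_Ici, iff_false]
        linarith
    rw [this, csInf_Ici]
  · refine le_antisymm (csInf_le (OrderBot.bddBelow _) ?_) zero_le
    have hp0 : (0 : ℝ) ≤ if a ≤ 0 then (p : ℝ) else 0 := by split_ifs <;> simp
    simp only [Set.mem_ofPred_eq]
    linarith

lemma quantile_twoPoint_mul (t a : ℝ≥0) {q : ℝ} (hq : q ∈ Set.Icc (0 : ℝ) 1) :
    quantile (twoPoint p hp (t * a)) q = t * quantile (twoPoint p hp a) q := by
  rw [quantile_twoPoint hp _ hq, quantile_twoPoint hp _ hq]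
  split_ifs <;> simp

lemma lintegral_quantile_twoPoint_le (a : ℝ≥0) :
    ∫⁻ q in Set.Icc (0 : ℝ) 1, (quantile (twoPoint p hp a) q : ℝ≥0∞) ≤ p * a := by
  calc ∫⁻ q in Set.Icc (0 : ℝ) 1, (quantile (twoPoint p hp a) q : ℝ≥0∞)
      = ∫⁻ q in Set.Icc (0 : ℝ) 1, (Set.Iio (p : ℝ)).indicator (fun _ => (a : ℝ≥0∞)) q := by
        refine setLIntegral_congr_fun measurableSet_Icc fun q hq => ?_
        simp only [quantile_twoPoint hp _ hq, Set.indicator, Set.mem_Iio]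
        split_ifs <;> simp
    _ = a * volume (Set.Iio (p : ℝ) ∩ Set.Icc 0 1) := by
        rw [lintegral_indicator_const measurableSet_Iio, Measure.restrict_apply measurableSet_Iio]
    _ ≤ a * volume (Set.Icc 0 (p : ℝ)) := by
        gcongr
        rintro x ⟨h1, h2, -⟩
        exact ⟨h2, h1.le⟩
    _ = p * a := by
        rw [Real.volume_Icc, sub_zero, ENNReal.ofReal_coe_nnreal, mul_comm]

end TwoPoint

/-! ### Profiles of two-point distributions -/

section Profile

variable {n : ℕ} {𝓕 : Fin n → Set Dist}

lemma secondHighest_le_highest (v : Fin n → ℝ≥0) : secondHighest v ≤ highest v :=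
  Finset.sup_le fun x _ => (min_le_left _ _).trans (Finset.le_sup (f := v) (Finset.mem_univ x.1))

lemma SPA_le_WEL (F : Profile 𝓕) : SPA F ≤ WEL F :=
  lintegral_mono fun v => ENNReal.coe_le_coe.2 (secondHighest_le_highest v)

instance isProbabilityMeasure_joint (F : Profile 𝓕) : IsProbabilityMeasure (joint F) := by
  unfold joint
  infer_instance

lemma lintegral_joint_apply (F : Profile 𝓕) (i : Fin n) :
    ∫⁻ v, (v i : ℝ≥0∞) ∂joint F = mean (F i) :=
  (measurePreserving_eval (fun i => ((F i : Dist) : Measure ℝ≥0)) i).lintegral_comp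
    (f := fun x : ℝ≥0 => (x : ℝ≥0∞)) measurable_coe_nnreal_ennreal

/-- This crude bound serves only to show that the welfare is finite. -/
lemma WEL_le_sum_mean (F : Profile 𝓕) : WEL F ≤ ∑ i, mean (F i) := by
  calc WEL F ≤ ∫⁻ v, ∑ i, (v i : ℝ≥0∞) ∂joint F := by
        refine lintegral_mono fun v => ?_
        have : highest v ≤ ∑ i, v i :=
          Finset.sup_le fun i hi => Finset.single_le_sum (f := v) (fun _ _ => zero_le) hi
        rw [← ENNReal.ofNNReal_finsetSum]
        exact ENNReal.coe_le_coe.2 this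
    _ = ∑ i, mean (F i) := by
        rw [lintegral_finsetSum _ fun i _ => by fun_prop]
        simp_rw [lintegral_joint_apply]

variable {p : ℝ≥0} {hp : p ≤ 1} {a : Fin n → ℝ≥0} {F : Profile 𝓕}

/-- The value vector in which exactly the buyers in `A` have their high value. -/
def activeVec (a : Fin n → ℝ≥0) (A : Finset (Fin n)) : Fin n → ℝ≥0 := fun i =>
  if i ∈ A then a i else 0

lemma activeVec_injective (ha : ∀ i, 0 < a i) : Function.Injective (activeVec a) := by
  intro A B h
  ext i
  have := congrFun h i
  have hi := (ha i).ne'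
  unfold activeVec at this
  by_cases h1 : i ∈ A <;> by_cases h2 : i ∈ B <;> simp_all

lemma le_joint_singleton_activeVec (hF : ∀ i, (F i : Dist) = twoPoint p hp (a i))
    (A : Finset (Fin n)) :
    ((p ^ A.card * (1 - p) ^ (n - A.card) : ℝ≥0) : ℝ≥0∞) ≤ joint F {activeVec a A} := by
  rw [joint, Measure.pi_singleton]
  calc ((p ^ A.card * (1 - p) ^ (n - A.card) : ℝ≥0) : ℝ≥0∞)
      = ∏ i, if i ∈ A then (p : ℝ≥0∞) else ((1 - p : ℝ≥0) : ℝ≥0∞) := by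
        rw [Finset.prod_ite, Finset.prod_const, Finset.prod_const, Finset.filter_mem_eq_inter,
          Finset.univ_inter, Finset.filter_notMem_eq_sdiff, ← Finset.compl_eq_univ_sdiff,
          Finset.card_compl, Fintype.card_fin]
        push_cast
        rfl
    _ ≤ _ := by
        refine Finset.prod_le_prod' fun i _ => ?_
        rw [hF, activeVec]
        split_ifs
        · exact le_twoPoint_singleton hp _
        · exact le_twoPoint_singleton_zero hp _

/-- A lower bound for an expectation by the contribution of some of the atoms. -/
lemma sum_activeVec_le_lintegral (hF : ∀ i, (F i : Dist) = twoPoint p hp (a i))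
    (ha : ∀ i, 0 < a i) (f : (Fin n → ℝ≥0) → ℝ≥0) (s : Finset (Finset (Fin n))) :
    ((∑ A ∈ s, f (activeVec a A) * (p ^ A.card * (1 - p) ^ (n - A.card)) : ℝ≥0) : ℝ≥0∞) ≤
      ∫⁻ v, (f v : ℝ≥0∞) ∂joint F := by
  calc ((∑ A ∈ s, f (activeVec a A) * (p ^ A.card * (1 - p) ^ (n - A.card)) : ℝ≥0) : ℝ≥0∞)
      ≤ ∑ A ∈ s, (f (activeVec a A) : ℝ≥0∞) * joint F {activeVec a A} := by
        rw [ENNReal.ofNNReal_finsetSum]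
        refine Finset.sum_le_sum fun A _ => ?_
        rw [ENNReal.coe_mul]
        gcongr
        exact le_joint_singleton_activeVec hF A
    _ = ∫⁻ v in ↑(s.map ⟨activeVec a, activeVec_injective ha⟩), (f v : ℝ≥0∞) ∂joint F := by
        rw [lintegral_finset, Finset.sum_map]
        rfl
    _ ≤ _ := setLIntegral_le_lintegral _ _

/-- Only the atoms with exactly one active buyer are counted. -/
lemma le_WEL_of_twoPoint (hF : ∀ i, (F i : Dist) = twoPoint p hp (a i)) (ha : ∀ i, 0 < a i) :
    (((∑ i, a i) * (p * (1 - p) ^ (n - 1)) : ℝ≥0) : ℝ≥0∞) ≤ WEL F := by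
  refine le_trans ?_ (sum_activeVec_le_lintegral hF ha highest
    (Finset.univ.map ⟨fun i => {i}, Finset.singleton_injective⟩))
  rw [ENNReal.coe_le_coe, Finset.sum_map, Finset.sum_mul]
  refine Finset.sum_le_sum fun i _ => ?_
  simp only [Function.Embedding.coeFn_mk, Finset.card_singleton, pow_one]
  gcongr
  refine le_trans ?_ (Finset.le_sup (f := activeVec a {i}) (Finset.mem_univ i))
  simp [activeVec]

/-- Only the atoms with exactly two active buyers are counted; on each of them the second-highest
value is at least `c`. -/
lemma le_SPA_of_twoPoint (hF : ∀ i, (F i : Dist) = twoPoint p hp (a i)) {c : ℝ≥0} (hc : 0 < c)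
    (ha : ∀ i, c ≤ a i) :
    ((n.choose 2 * (c * (p ^ 2 * (1 - p) ^ (n - 2))) : ℝ≥0) : ℝ≥0∞) ≤ SPA F := by
  refine le_trans ?_ (sum_activeVec_le_lintegral hF (fun i => hc.trans_le (ha i)) secondHighest
    (Finset.powersetCard 2 Finset.univ))
  rw [ENNReal.coe_le_coe]
  have : ∀ A ∈ Finset.powersetCard 2 (Finset.univ : Finset (Fin n)),
      c * (p ^ 2 * (1 - p) ^ (n - 2)) ≤
        secondHighest (activeVec a A) * (p ^ A.card * (1 - p) ^ (n - A.card)) := by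
    intro A hA
    rw [(Finset.mem_powersetCard.1 hA).2]
    gcongr
    obtain ⟨i, j, hij, rfl⟩ := Finset.card_eq_two.1 (Finset.mem_powersetCard.1 hA).2
    refine le_trans ?_ (Finset.le_sup
      (f := fun x : Fin n × Fin n => min (activeVec a {i, j} x.1) (activeVec a {i, j} x.2))
      (b := (i, j)) (by simpa using hij))
    simp [activeVec, ha]
  refine le_trans (le_of_eq ?_) (Finset.card_nsmul_le_sum _ _ _ this)
  rw [Finset.card_powersetCard, Finset.card_univ, Fintype.card_fin, nsmul_eq_mul]

end Profile

/-! ### Consequences of validity -/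

namespace Mechanism

variable {n : ℕ} {𝓕 : Fin n → Set Dist} (M : Mechanism 𝓕)

/-- The expected value obtained from fixed reports is homogeneous in the true high value. -/
lemma expectedValue_twoPoint_mul {p : ℝ≥0} (hp : p ≤ 1) (i : Fin n) (B : Profile 𝓕) (t a : ℝ≥0) :
    M.expectedValue i B (twoPoint p hp (t * a)) = t * M.expectedValue i B (twoPoint p hp a) := by
  unfold expectedValue
  rw [← lintegral_const_mul' _ _ ENNReal.coe_ne_top]
  refine setLIntegral_congr_fun measurableSet_Icc fun q hq => ?_
  rw [← lintegral_const_mul' _ _ ENNReal.coe_ne_top]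
  refine lintegral_congr fun b => ?_
  rw [quantile_twoPoint_mul hp _ _ hq]
  push_cast
  ring

lemma expectedValue_twoPoint_le {p : ℝ≥0} (hp : p ≤ 1) (i : Fin n) (B : Profile 𝓕) (a : ℝ≥0) :
    M.expectedValue i B (twoPoint p hp a) ≤ p * a := by
  refine le_trans (lintegral_mono fun q => ?_) (lintegral_quantile_twoPoint_le hp a)
  calc ∫⁻ b, (M.alloc i (Function.update b i (quantile (B i) q)) B : ℝ≥0∞) *
          (quantile (twoPoint p hp a) q : ℝ≥0∞) ∂joint B
      ≤ ∫⁻ _, (quantile (twoPoint p hp a) q : ℝ≥0∞) ∂joint B := by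
        refine lintegral_mono fun b => ?_
        refine mul_le_of_le_one_left' ?_
        exact ENNReal.coe_le_one_iff.2 (M.alloc_le_one _ _ _)
    _ = _ := by simp

variable {M}

lemma utility_eq_coe {i : Fin n} {B : Profile 𝓕} {D : Dist} (h : M.expectedValue i B D ≠ ⊤) :
    M.utility i B D = ((M.expectedValue i B D).toReal - M.pay i B : ℝ) := by
  rw [utility, EReal.coe_sub, EReal.coe_ennreal_toReal h]

lemma ExAnteIR.pay_le (hM : M.ExAnteIR) (F : Profile 𝓕) (i : Fin n)
    (h : M.expectedValue i F (F i) ≠ ⊤) : M.pay i F ≤ (M.expectedValue i F (F i)).toReal := by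
  have := hM F i
  rw [utility_eq_coe h] at this
  have : (0 : ℝ) ≤ (M.expectedValue i F (F i)).toReal - M.pay i F := by exact_mod_cast this
  linarith

end Mechanism

/-! ### Few buyers: point masses -/

section PointMass

variable {n : ℕ} {𝓕 : Fin n → Set Dist} {F : Profile 𝓕}

lemma ae_joint_eq_one (hF : ∀ i, (F i : Dist) = twoPoint 1 le_rfl 1) :
    ∀ᵐ b ∂joint F, b = 1 := by
  have h1 : joint F {1} = 1 := by
    refine le_antisymm prob_le_one ?_
    have := le_joint_singleton_activeVec (a := 1) hF Finset.univ
    have h : activeVec (1 : Fin n → ℝ≥0) Finset.univ = 1 := by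
      ext i
      simp [activeVec]
    rw [h] at this
    simpa using this
  exact (prob_compl_eq_zero_iff (measurableSet_singleton _)).2 h1

lemma one_le_SPA_of_pointMass (hn : 2 ≤ n) (hF : ∀ i, (F i : Dist) = twoPoint 1 le_rfl 1) :
    1 ≤ SPA F := by
  have h : ∫⁻ _, 1 ∂joint F ≤ SPA F := by
    refine lintegral_mono_ae ?_
    filter_upwards [ae_joint_eq_one hF] with b hb
    rw [hb, ENNReal.one_le_coe_iff]
    exact Finset.le_sup (f := fun x : Fin n × Fin n => min ((1 : Fin n → ℝ≥0) x.1)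
      ((1 : Fin n → ℝ≥0) x.2)) (b := (⟨0, by omega⟩, ⟨1, by omega⟩)) (by simp) |>.trans' (by simp)
  simpa using h

/-- Individual rationality bounds each payment by the allocation at the all-ones bid vector, and
feasibility bounds the sum of these. -/
lemma Mechanism.Valid.rev_le_one_of_pointMass {M : Mechanism 𝓕} (hM : M.Valid)
    (hF : ∀ i, (F i : Dist) = twoPoint 1 le_rfl 1) : M.rev F ≤ 1 := by
  have hev : ∀ i, M.expectedValue i F (F i) ≤ M.alloc i 1 F := by
    intro i
    calc M.expectedValue i F (F i) ≤ ∫⁻ _ in Set.Icc (0 : ℝ) 1, (M.alloc i 1 F : ℝ≥0∞) := by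
          refine setLIntegral_mono' measurableSet_Icc fun q hq => ?_
          simp only [hF, quantile_twoPoint _ _ hq]
          split_ifs with h
          · calc ∫⁻ b, (M.alloc i (Function.update b i 1) F : ℝ≥0∞) * ((1 : ℝ≥0) : ℝ≥0∞) ∂joint F
                ≤ ∫⁻ _, (M.alloc i 1 F : ℝ≥0∞) ∂joint F := by
                  refine lintegral_mono_ae ?_
                  filter_upwards [ae_joint_eq_one hF] with b hb
                  have : Function.update b i 1 = 1 := by
                    rw [hb]; exact Function.update_eq_self i _
                  rw [this, ENNReal.coe_one, mul_one]
              _ = M.alloc i 1 F := by simp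
          · simp
      _ = M.alloc i 1 F := by simp
  calc M.rev F ≤ ∑ i, (M.alloc i 1 F : ℝ) := by
        refine Finset.sum_le_sum fun i _ => ?_
        refine (hM.exAnteIR.pay_le F i (ne_top_of_le_ne_top ENNReal.coe_ne_top (hev i))).trans ?_
        exact ENNReal.toReal_mono ENNReal.coe_ne_top (hev i)
    _ ≤ 1 := by exact_mod_cast hM.feasible 1 F

end PointMass

/-! ### Many buyers: rare high values of random scale -/

section Scale

variable {n : ℕ} {𝓕 : Fin n → Set Dist}

/-- The profile in which buyer `i` has value `2 ^ t i * p⁻¹` with probability `p`, and value `0`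
otherwise. -/
def scaleProfile (h𝓕 : ∀ i, {D : Dist | mean D < ⊤} ⊆ 𝓕 i) (p : ℝ≥0) (hp : p ≤ 1)
    (t : Fin n → ℕ) : Profile 𝓕 := fun i =>
  ⟨twoPoint p hp (2 ^ t i * p⁻¹), h𝓕 i (mean_twoPoint_lt_top hp _)⟩

variable (h𝓕 : ∀ i, {D : Dist | mean D < ⊤} ⊆ 𝓕 i) {p : ℝ≥0} (hp : p ≤ 1)

lemma scaleProfile_update (t : Fin n → ℕ) (i : Fin n) (k : ℕ) :
    scaleProfile h𝓕 p hp (Function.update t i k) =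
      Function.update (scaleProfile h𝓕 p hp t) i
        ⟨twoPoint p hp (2 ^ k * p⁻¹), h𝓕 i (mean_twoPoint_lt_top hp _)⟩ := by
  ext1 j
  by_cases h : j = i
  · subst h
    simp [scaleProfile]
  · rw [Function.update_of_ne h]
    simp [scaleProfile, Function.update_of_ne h]

/-- Whatever the other buyers report, a buyer of random scale pays at most `1` in expectation. -/
lemma sum_scaleWeight_mul_pay_scaleProfile_le {M : Mechanism 𝓕} (hM : M.Valid) (hp0 : 0 < p)
    (m : ℕ) (t : Fin n → ℕ) (i : Fin n) :
    ∑ k : Fin (m + 1), scaleWeight m k *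
      M.pay i (scaleProfile h𝓕 p hp (Function.update t i k)) ≤ 1 := by
  set G : ℕ → Profile 𝓕 := fun k => scaleProfile h𝓕 p hp (Function.update t i k) with hG
  have hle : ∀ k, M.expectedValue i (G k) (twoPoint p hp p⁻¹) ≤ 1 := fun k => by
    refine (M.expectedValue_twoPoint_le hp i (G k) _).trans_eq ?_
    rw [← ENNReal.coe_mul, mul_inv_cancel₀ hp0.ne', ENNReal.coe_one]
  have hut : ∀ j k, M.utility i (G j) (twoPoint p hp (2 ^ k * p⁻¹)) =
      ((2 ^ k * (M.expectedValue i (G j) (twoPoint p hp p⁻¹)).toReal - M.pay i (G j) : ℝ) :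
        EReal) := by
    intro j k
    have hmul := M.expectedValue_twoPoint_mul hp i (G j) (2 ^ k) p⁻¹
    rw [Mechanism.utility_eq_coe, hmul, ENNReal.toReal_mul]
    · simp
    · rw [hmul]
      exact ENNReal.mul_ne_top ENNReal.coe_ne_top (ne_top_of_le_ne_top ENNReal.one_ne_top (hle j))
  have hGi : ∀ k, (G k i : Dist) = twoPoint p hp (2 ^ k * p⁻¹) := fun k => by
    simp [hG, scaleProfile]
  -- The menu entry for report `k` has as its slope the value obtained by the unit-scale type, whose
  -- mean is 1.
  refine sum_scaleWeight_mul_pay_le_one m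
    (fun k => (M.expectedValue i (G k) (twoPoint p hp p⁻¹)).toReal) (fun k => M.pay i (G k))
    ?_ ?_ ?_
  · exact ENNReal.toReal_le_of_le_ofReal zero_le_one (by simpa using hle m)
  · have := hM.exAnteIR (G 0) i
    rw [hGi, hut, EReal.coe_nonneg] at this
    simpa using this
  · intro k _
    have := hM.exAnteIC i ⟨twoPoint p hp (2 ^ (k + 1) * p⁻¹), h𝓕 i (mean_twoPoint_lt_top hp _)⟩
      (G k)
    have hup : Function.update (G k) i ⟨twoPoint p hp (2 ^ (k + 1) * p⁻¹),
        h𝓕 i (mean_twoPoint_lt_top hp _)⟩ = G (k + 1) := by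
      rw [hG]
      simp only [scaleProfile_update, Function.update_idem]
    rw [hup] at this
    simp only [hut, EReal.coe_le_coe_iff] at this
    exact this

/-- The expected revenue over random scales is at most the number of buyers. -/
lemma sum_prod_scaleWeight_mul_rev_le {M : Mechanism 𝓕} (hM : M.Valid) (hp0 : 0 < p) (m : ℕ) :
    ∑ t : Fin n → Fin (m + 1), (∏ j, scaleWeight m (t j)) *
      M.rev (scaleProfile h𝓕 p hp fun j => t j) ≤ n := by
  have hpay : ∀ i, ∑ t : Fin n → Fin (m + 1), (∏ j, scaleWeight m (t j)) *
      M.pay i (scaleProfile h𝓕 p hp fun j => t j) ≤ 1 := by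
    intro i
    have h := sum_prod_mul_resample (fun k : Fin (m + 1) => scaleWeight m k)
      (fun t => M.pay i (scaleProfile h𝓕 p hp fun j => t j)) i
    rw [sum_scaleWeight, one_mul] at h
    rw [← h]
    calc _ ≤ ∑ t : Fin n → Fin (m + 1), (∏ j, scaleWeight m (t j)) * 1 := by
          refine Finset.sum_le_sum fun t _ => ?_
          refine mul_le_mul_of_nonneg_left ?_
            (Finset.prod_nonneg fun j _ => scaleWeight_nonneg _ _)
          refine le_of_eq_of_le (Finset.sum_congr rfl fun k _ => ?_)
            (sum_scaleWeight_mul_pay_scaleProfile_le h𝓕 hp hM hp0 m (fun j => t j) i)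
          congr 3
          ext j
          by_cases hj : j = i
          · subst hj; simp
          · simp [Function.update_of_ne hj]
      _ = 1 := by
          simp only [mul_one]
          exact sum_prod_eq_one (sum_scaleWeight m)
  simp only [Mechanism.rev, Finset.mul_sum]
  rw [Finset.sum_comm]
  refine (Finset.sum_le_sum fun i _ => hpay i).trans_eq ?_
  simp

lemma WEL_scaleProfile_lt_top (t : Fin n → ℕ) : WEL (scaleProfile h𝓕 p hp t) < ⊤ :=
  (WEL_le_sum_mean _).trans_lt
    (ENNReal.sum_lt_top.2 fun _ _ => mean_twoPoint_lt_top hp _)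

/-- Bernoulli's inequality: `(1 - p) ^ l ≥ 1 - l * p ≥ 1 - n * p = 1 / 2`. -/
lemma half_le_one_sub_pow (hn : 0 < n) (hpn : p = (2 * n : ℝ≥0)⁻¹) {l : ℕ} (hl : l ≤ n) :
    1 / 2 ≤ ((1 - p : ℝ≥0) : ℝ) ^ l := by
  have hn0 : (1 : ℝ) ≤ n := by exact_mod_cast hn
  have hp' : (p : ℝ) = (2 * n : ℝ)⁻¹ := by rw [hpn]; push_cast; rfl
  have hp1 : p ≤ 1 := by
    rw [← NNReal.coe_le_coe, hp', NNReal.coe_one]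
    exact inv_le_one_of_one_le₀ (by linarith)
  have hp1' : (p : ℝ) ≤ 1 := by exact_mod_cast hp1
  rw [NNReal.coe_sub hp1, NNReal.coe_one, sub_eq_add_neg]
  refine le_trans ?_ (one_add_mul_le_pow (by linarith) l)
  have : (l : ℝ) * p ≤ n * p := by gcongr
  have h2 : (n : ℝ) * p = 1 / 2 := by rw [hp']; field_simp
  linarith

lemma le_WEL_scaleProfile (hn : 0 < n) (hpn : p = (2 * n : ℝ≥0)⁻¹) (t : Fin n → ℕ) :
    1 / 2 * ∑ i, (2 : ℝ) ^ t i ≤ (WEL (scaleProfile h𝓕 p hp t)).toReal := by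
  have hp0 : 0 < p := by rw [hpn]; positivity
  have h := le_WEL_of_twoPoint (hp := hp) (F := scaleProfile h𝓕 p hp t) (fun i => rfl)
    (fun i => by positivity)
  have h' := ENNReal.toReal_mono (WEL_scaleProfile_lt_top h𝓕 hp t).ne h
  refine le_trans ?_ h'
  rw [ENNReal.coe_toReal, ← Finset.sum_mul]
  have hp0' : (p : ℝ) ≠ 0 := by exact_mod_cast hp0.ne'
  push_cast
  have h3 := half_le_one_sub_pow hn hpn (Nat.sub_le n 1)
  have hT : (0 : ℝ) ≤ ∑ i, (2 : ℝ) ^ t i := by positivity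
  calc 1 / 2 * ∑ i, (2 : ℝ) ^ t i ≤ ((1 - p : ℝ≥0) : ℝ) ^ (n - 1) * ∑ i, (2 : ℝ) ^ t i := by
        gcongr
    _ = _ := by field_simp

lemma le_SPA_scaleProfile (hn : 2 ≤ n) (hpn : p = (2 * n : ℝ≥0)⁻¹) (t : Fin n → ℕ) :
    (n : ℝ) / 16 ≤ (SPA (scaleProfile h𝓕 p hp t)).toReal := by
  have hn2 : (2 : ℝ) ≤ n := by exact_mod_cast hn
  have hp0 : 0 < p := by rw [hpn]; positivity
  have h := le_SPA_of_twoPoint (hp := hp) (F := scaleProfile h𝓕 p hp t) (fun i => rfl)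
    (inv_pos.2 hp0) (fun i => le_mul_of_one_le_left zero_le (one_le_pow₀ one_le_two))
  have h' := ENNReal.toReal_mono
    ((SPA_le_WEL _).trans_lt (WEL_scaleProfile_lt_top h𝓕 hp t)).ne h
  refine le_trans ?_ h'
  rw [ENNReal.coe_toReal]
  have hp' : (p : ℝ) = (2 * n : ℝ)⁻¹ := by rw [hpn]; push_cast; rfl
  have h3 := half_le_one_sub_pow (by omega) hpn (Nat.sub_le n 2)
  push_cast
  rw [Nat.cast_choose_two]
  have hc : (0 : ℝ) ≤ n * (n - 1) / 2 := by
    have : (0 : ℝ) ≤ n - 1 := by linarith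
    positivity
  -- The right-hand side equals `(n - 1) / 8`, which is at least `n / 16` because `n ≥ 2`.
  calc (n : ℝ) / 16 ≤ n * (n - 1) / 2 * ((p : ℝ)⁻¹ * ((p : ℝ) ^ 2 * (1 / 2))) := by
        rw [hp']
        field_simp
        nlinarith
    _ ≤ _ := by gcongr

end Scale

/-! ### Comparison of the benchmarks -/

/-- The bound by `c` is `(y - 2 * c) ^ 2 ≥ 0`. A quadratic minorant of the truncation replaces tail
estimates by moments. -/
lemma sub_sq_div_le_min {y c : ℝ} (hc : 0 < c) : y - y ^ 2 / (4 * c) ≤ min y c := by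
  refine le_min (sub_le_self _ (by positivity)) ?_
  rw [sub_le_iff_le_add, ← sub_le_iff_le_add', le_div_iff₀ (by positivity)]
  nlinarith [sq_nonneg (y - 2 * c)]

/-- With `τ` and `Q` the first two moments of a scale, `P = 2 ^ K` and `S = K + log₂ n`, the random
benchmark exceeds the bound on the expected revenue. -/
lemma lt_expected_benchmark {n S P τ Q : ℝ} (hn : 0 < n) (hS : 64 < S) (hP : 64 ≤ P)
    (hτ1 : S / 8 ≤ τ) (hτ2 : τ ≤ S / 8 + 1) (hQ : Q ≤ 3 / 2 * (P * n)) :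
    n < 32 / S * (n * τ) - (32 / S) ^ 2 * (n * Q + (n * τ) ^ 2) / (4 * (P * (n / 16))) := by
  have hS0 : 0 < S := by linarith
  have hP0 : 0 < P := by linarith
  set r := τ / S with hr
  have hτ : τ = r * S := by rw [hr]; field_simp
  have hr1 : 1 / 8 ≤ r := by rw [hr, le_div_iff₀ hS0]; linarith
  have hr2 : r ≤ 9 / 64 := by rw [hr, div_le_iff₀ hS0]; linarith
  -- The main term is at least `4 * n`; the two losses are at most `3 / 2 * n` and `81 / 64 * n`,
  -- leaving more than `n`.
  have e : 32 / S * (n * τ) - (32 / S) ^ 2 * (n * Q + (n * τ) ^ 2) / (4 * (P * (n / 16))) =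
      32 * r * n - (64 / S) ^ 2 * (Q / P) - 4096 * r ^ 2 * n / P := by
    rw [hτ]
    field_simp
    ring
  have h1 : (64 / S) ^ 2 ≤ 1 := pow_le_one₀ (by positivity) ((div_le_one hS0).2 hS.le)
  have h2 : Q / P ≤ 3 / 2 * n := by rw [div_le_iff₀ hP0]; linarith
  have h3 : (64 / S) ^ 2 * (Q / P) ≤ 3 / 2 * n := by
    calc (64 / S) ^ 2 * (Q / P) ≤ (64 / S) ^ 2 * (3 / 2 * n) := by gcongr
      _ ≤ 1 * (3 / 2 * n) := by gcongr
      _ = _ := one_mul _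
  have h4 : 4096 * r ^ 2 * n / P ≤ 81 / 64 * n := by
    rw [div_le_iff₀ hP0]
    have : r ^ 2 ≤ (9 / 64) ^ 2 := by gcongr
    calc 4096 * r ^ 2 * n ≤ 4096 * (9 / 64) ^ 2 * n := by gcongr
      _ = 81 / 64 * n * 64 := by ring
      _ ≤ 81 / 64 * n * P := by gcongr
  rw [e]
  nlinarith

end DistReport

end

/-! ### The averaging argument -/

theorem mainTheorem2 (n : ℕ) (hn : 2 ≤ n) (K : ℝ) (hK : 6 ≤ K)
    (𝓕 : Fin n → Set DistReport.Dist)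
    (h𝓕 : ∀ i, {D : DistReport.Dist | DistReport.mean D < ⊤} ⊆ 𝓕 i)
    (M : DistReport.Mechanism 𝓕) (hM : M.Valid) :
    ∃ F : DistReport.Profile 𝓕,
      0 < DistReport.SPA F ∧ DistReport.WEL F < ⊤ ∧
        M.rev F ≤ min (64 / (K + Real.logb 2 n) * (DistReport.WEL F).toReal)
          ((2 : ℝ) ^ K * (DistReport.SPA F).toReal) := by
  open DistReport in
  have hn2 : (2 : ℝ) ≤ n := by exact_mod_cast hn
  have hL : 0 ≤ Real.logb 2 n := Real.logb_nonneg one_lt_two (by linarith)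
  have hP : (64 : ℝ) ≤ 2 ^ K := by
    calc (64 : ℝ) = 2 ^ (6 : ℝ) := by norm_num
      _ ≤ 2 ^ K := Real.rpow_le_rpow_of_exponent_le one_le_two hK
  set S := K + Real.logb 2 n with hSdef
  have hS0 : 0 < S := by linarith
  rcases le_or_gt S 64 with hS | hS
  · let F : Profile 𝓕 := fun i => ⟨twoPoint 1 le_rfl 1, h𝓕 i (mean_twoPoint_lt_top le_rfl 1)⟩
    have hF : ∀ i, (F i : Dist) = twoPoint 1 le_rfl 1 := fun i => rfl
    have hWEL : WEL F < ⊤ := (WEL_le_sum_mean F).trans_lt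
      (ENNReal.sum_lt_top.2 fun i _ => mean_twoPoint_lt_top le_rfl 1)
    have hSPA : 1 ≤ SPA F := one_le_SPA_of_pointMass hn hF
    have hS1 : 1 ≤ (SPA F).toReal := by
      simpa using ENNReal.toReal_mono ((SPA_le_WEL F).trans_lt hWEL).ne hSPA
    have hW1 : 1 ≤ (WEL F).toReal := by
      simpa using ENNReal.toReal_mono hWEL.ne (hSPA.trans (SPA_le_WEL F))
    refine ⟨F, one_pos.trans_le hSPA, hWEL, (hM.rev_le_one_of_pointMass hF).trans (le_min ?_ ?_)⟩
    · exact one_le_mul_of_one_le_of_one_le ((one_le_div hS0).2 hS) hW1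
    · exact one_le_mul_of_one_le_of_one_le (by linarith) hS1
  · obtain ⟨p, hpn⟩ : ∃ p : NNReal, p = (2 * n : NNReal)⁻¹ := ⟨_, rfl⟩
    have hp0 : 0 < p := by rw [hpn]; positivity
    have hp : p ≤ 1 := by
      rw [hpn]
      refine inv_le_one_of_one_le₀ ?_
      exact_mod_cast (by omega : 1 ≤ 2 * n)
    -- This is large enough for the mean scale `m / 2 + 1` to be at least `S / 8`, and small enough
    -- that `2 ^ m ≤ 2 ^ S = 2 ^ K * n`.
    set m := ⌊S / 4⌋₊ with hm
    have hm1 : (m : ℝ) ≤ S / 4 := Nat.floor_le (by positivity)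
    have hm2 : S / 4 < m + 1 := Nat.lt_floor_add_one _
    have hQ : (2 : ℝ) ^ m ≤ 2 ^ K * n := by
      calc (2 : ℝ) ^ m = 2 ^ (m : ℝ) := (Real.rpow_natCast _ _).symm
        _ ≤ 2 ^ S := Real.rpow_le_rpow_of_exponent_le one_le_two (by linarith)
        _ = 2 ^ K * n := by
          rw [hSdef, Real.rpow_add two_pos, Real.rpow_logb two_pos (by norm_num) (by linarith)]
    by_contra! hcon
    have hC : 0 < (2 : ℝ) ^ K * (n / 16) := by positivity
    -- Under the contrary assumption, revenue on every scale profile exceeds the minimum, hence its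
    -- quadratic minorant with `c = 2 ^ K * (n / 16)`.
    have hrev : ∀ t : Fin n → Fin (m + 1),
        32 / S * ∑ i, (2 : ℝ) ^ (t i : ℕ) -
          (32 / S * ∑ i, (2 : ℝ) ^ (t i : ℕ)) ^ 2 / (4 * (2 ^ K * (n / 16))) ≤
        M.rev (scaleProfile h𝓕 p hp fun j => t j) := by
      intro t
      have hW := le_WEL_scaleProfile h𝓕 hp (by omega) hpn fun j => t j
      have hSp := le_SPA_scaleProfile h𝓕 hp hn hpn fun j => t j
      have hSpos : 0 < SPA (scaleProfile h𝓕 p hp fun j => t j) := by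
        rw [pos_iff_ne_zero]
        intro h0
        rw [h0, ENNReal.toReal_zero] at hSp
        linarith
      refine (sub_sq_div_le_min hC).trans (le_trans (min_le_min ?_ ?_)
        (hcon _ hSpos (WEL_scaleProfile_lt_top h𝓕 hp _)).le)
      · calc 32 / S * ∑ i, (2 : ℝ) ^ (t i : ℕ)
            = 64 / S * (1 / 2 * ∑ i, (2 : ℝ) ^ (t i : ℕ)) := by ring
          _ ≤ _ := by gcongr
      · gcongr
    have hsum := (Finset.sum_le_sum fun t (_ : t ∈ Finset.univ) =>
      mul_le_mul_of_nonneg_left (hrev t)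
        (Finset.prod_nonneg fun j _ => scaleWeight_nonneg m (t j))).trans
      (sum_prod_scaleWeight_mul_rev_le h𝓕 hp hM hp0 m)
    have hw := sum_scaleWeight m
    have h1 := sum_prod_mul_sum (ι := Fin n) hw fun k => 2 ^ (k : ℕ)
    have h2 := sum_prod_mul_sum_sq_le (ι := Fin n) hw fun k => 2 ^ (k : ℕ)
    rw [sum_scaleWeight_mul_scale, Fintype.card_fin] at h1 h2
    have hlt := lt_expected_benchmark (n := n) (S := S) (P := 2 ^ K) (τ := m / 2 + 1)
      (by linarith) hS hP (by linarith) (by linarith)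
      ((sum_scaleWeight_mul_scale_sq_le m).trans (by linarith))
    refine absurd hsum (not_le.2 (hlt.trans_le ?_))
    have e : ∀ t : Fin n → Fin (m + 1), (∏ j, scaleWeight m (t j)) *
        (32 / S * ∑ i, (2 : ℝ) ^ (t i : ℕ) -
          (32 / S * ∑ i, (2 : ℝ) ^ (t i : ℕ)) ^ 2 / (4 * (2 ^ K * (n / 16)))) =
        32 / S * ((∏ j, scaleWeight m (t j)) * ∑ i, (2 : ℝ) ^ (t i : ℕ)) -
        (32 / S) ^ 2 / (4 * (2 ^ K * (n / 16))) *
          ((∏ j, scaleWeight m (t j)) * (∑ i, (2 : ℝ) ^ (t i : ℕ)) ^ 2) := by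
      intro t
      ring
    simp only [e]
    rw [Finset.sum_sub_distrib, ← Finset.mul_sum, ← Finset.mul_sum, h1, mul_div_right_comm]
    gcongr
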